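/- Let $V$ be a finite vertex set with at least two elements, carrying a graph with nonnegative edge weights (possibly directed, with self-loops) and positive vertex weights, together with a random walk on $V$ whose transition matrix $P$ is row-stochastic and irreducible, with stationary distribution $\phi$ (so $\phi P=\phi$, $\phi>0$, $\sum_v\phi(v)=1$). How $P$ is built from the weights is arbitrary. For $S\subseteq V$ put $\mathrm{vol}(S)=\sum_{u\in S}\phi(u)$ and, for $\emptyset\ne S\ne V$, $$\Phi(S)=\frac{\sum_{u\in S,\,v\notin S}\phi(u)P_{u,v}}{\min(\mathrm{vol}(S),1-\mathrm{vol}(S))}.$$ For $S\ne\emptyset$ let $\psi_S(v)=\phi(v)/\mathrm{vol}(S)$ for $v\in S$ and $\psi_S(v)=0$ otherwise. For $0<\alpha\le 1$ and a distribution $s$ on $V$ let $\mathrm{pr}(\alpha,s)=\alpha\sum_{k\ge0}(1-\alpha)^k sM^k$ with $M=\frac12(I+P)$; it is the unique solution $p$ of $p=\alpha s+(1-\alpha)pM$. For a distribution $p$ on $V$ with support of size $N_p$, list the vertices so that $p(v)/\phi(v)$ is non-increasing (ties broken arbitrarily), let $S^p_j$ be the set of the first $j$ vertices, and let $\Phi(p)$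 be the minimum of $\Phi(S^p_j)$ over all $1\le j\le N_p$ with $S^p_j\neq V$. For each $S\subsetneq V$ let $S^*$ be a set of minimum conductance among all nonempty proper subsets of $V$ containing $S$ (chosen by a fixed rule if there are several). Draw $S$ uniformly at random from all subsets of $V$, and consider the conditions 1. $S\neq V$ and $\mathrm{vol}(S^*)\le\frac12$; 2. $S^*$ is also the chosen optimal set for $S^*\setminus S$, that is, $(S^*\setminus S)^*=S^*$. There is a universal constant $K>0$ such that, with $\alpha=\Phi(S^*)$, conditionally on (1) and (2), with probability at least $\frac12$ the set $S$ is nonempty and $$\Phi\bigl(\mathrm{pr}(\alpha,\psi_S)\bigr)<K\sqrt{\Phi(S^*)}$$ for every way of breaking ties in the sweep order. Conditionally on (1), (2) and $\mathrm{vol}(S^*)\le\frac13$, with probability at least $\frac12$ the set $S$ is nonempty and, again for every way of breaking ties, $$\Phi\bigl(\mathrm{pr}(\alpha,\psi_S)\bigr)<\sqrt{235\,\Phi(S^*)}.$$ Both statements remain true when one conditions in addition on $S^*=C$ for a fixed set $C$. (A conditional statement is void if the conditioning event has probability $0$.) -/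

import Mathlib

open scoped ENNReal Matrix

/-- A finite weighted graph, possibly directed and with self-loops, together with a random walk
on it. `adj u v = 0` means that there is no edge from `u` to `v`. How the transition matrix is
built from the weights is left to the application, so `P` may be any irreducible row-stochastic
matrix; `φ` is its stationary distribution. -/
structure WeightedGraphWalk (V : Type*) [Fintype V] [DecidableEq V] where
  /-- edge weights -/
  adj : Matrix V V ℝ
  adj_nonneg : ∀ u v, 0 ≤ adj u v
  /-- vertex weights -/
  weight : V → ℝ
  weight_pos : ∀ v, 0 < weight v
  /-- transition matrix of the random walk -/
  P : Matrix V V ℝ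
  stochastic : P ∈ Matrix.rowStochastic ℝ V
  irreducible : P.IsIrreducible
  /-- stationary distribution of the random walk -/
  φ : V → ℝ
  φ_pos : ∀ v, 0 < φ v
  φ_sum : ∑ v, φ v = 1
  φ_stationary : φ ᵥ* P = φ

namespace WeightedGraphWalk

noncomputable section

variable {V : Type*} [Fintype V] [DecidableEq V] (G : WeightedGraphWalk V)

/-- Volume of a vertex set. -/
def vol (S : Finset V) : ℝ := ∑ v ∈ S, G.φ v

/-- Volume of the boundary of a vertex set. -/
def boundary (S : Finset V) : ℝ := ∑ u ∈ S, ∑ v ∈ Sᶜ, G.φ u * G.P u v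

/-- Conductance of a vertex set, meaningful for nonempty proper subsets only. -/
def conductance (S : Finset V) : ℝ := G.boundary S / min (G.vol S) (1 - G.vol S)

/-- `C` has the smallest conductance among all vertex sets containing `S`, where the competing sets
are those whose conductance is defined: the nonempty proper subsets of `V`. -/
def IsOptimal (S C : Finset V) : Prop :=
  (S ⊆ C ∧ C.Nonempty ∧ C ≠ Finset.univ) ∧
    ∀ T : Finset V, S ⊆ T → T.Nonempty → T ≠ Finset.univ → G.conductance C ≤ G.conductance T

/-- Transition matrix of the lazy random walk. -/
def lazyP : Matrix V V ℝ := (1 / 2 : ℝ) • (1 + G.P)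

/-- Lazy PageRank vector `α ∑ₖ (1 - α)ᵏ s Mᵏ`, where `M` is the lazy transition matrix. For
`0 < α ≤ 1` the series converges to the only solution of `p = α s + (1 - α) p M`. -/
def pageRank (α : ℝ) (s : V → ℝ) : V → ℝ :=
  fun v => α * ∑' k : ℕ, (1 - α) ^ k * (s ᵥ* G.lazyP ^ k) v

/-- Starting distribution of a nonempty vertex set: the stationary distribution restricted to it
and normalized. -/
def startDist (S : Finset V) : V → ℝ := fun v => if v ∈ S then G.φ v / G.vol S else 0

/-- `e` lists the vertices by non-increasing ratio `p v / φ v`; ties are broken arbitrarily. -/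
def IsSweepOrder (p : V → ℝ) (e : Fin (Fintype.card V) ≃ V) : Prop :=
  Antitone fun i => p (e i) / G.φ (e i)

/-- The first `j` vertices in the order `e`. -/
def sweepSet (e : Fin (Fintype.card V) ≃ V) (j : ℕ) : Finset V :=
  Finset.univ.filter fun v => (e.symm v : ℕ) < j

/-- The smallest conductance of the sweep sets `S_1, …, S_N` of `p` in the order `e`, where `N` is
the size of the support of `p`. The set of all vertices, whose conductance is not defined, does not
count as a cut. The value is `⊤` if there is no sweep cut. -/
def bestSweep (p : V → ℝ) (e : Fin (Fintype.card V) ≃ V) : WithTop ℝ :=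
  ((Finset.Icc 1 (Finset.univ.filter fun v => p v ≠ 0).card).filter
    fun j => sweepSet e j ≠ Finset.univ).inf fun j => ((G.conductance (sweepSet e j) : ℝ) : WithTop ℝ)

/-- For the lazy PageRank vector started from `S` with restart probability `α`, the best sweep cut
has conductance less than `b`, however ties in the sweep order are broken. This fails for `S = ∅`,
which yields no sweep cut. -/
def SweepBelow (α : ℝ) (S : Finset V) (b : ℝ) : Prop :=
  ∀ e : Fin (Fintype.card V) ≃ V, G.IsSweepOrder (G.pageRank α (G.startDist S)) e →
    G.bestSweep (G.pageRank α (G.startDist S)) e < (b : WithTop ℝ)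

/-- The seed sets `S` whose optimal set `S* = opt S` has volume at most `r` and is also the optimal
set for `S* \ S`. The set of all vertices has no optimal set and is left out. -/
def goodSeeds (opt : Finset V → Finset V) (r : ℝ) : Set (Finset V) :=
  {S | S ≠ Finset.univ ∧ G.vol (opt S) ≤ r ∧ opt (opt S \ S) = opt S}

/-- The seed sets `S` for which the sweep with `α = Φ(S*)`, `S* = opt S`, finds a cut of conductance
less than `f (Φ(S*))`. -/
def successSeeds (opt : Finset V → Finset V) (f : ℝ → ℝ) : Set (Finset V) :=
  {S | G.SweepBelow (G.conductance (opt S)) S (f (G.conductance (opt S)))}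

end

end WeightedGraphWalk

/-- Probability of an event for a seed set drawn uniformly from all subsets of `V`. -/
noncomputable def seedProb {V : Type*} [Fintype V] [DecidableEq V] (E : Set (Finset V)) : ℝ≥0∞ :=
  (PMF.uniformOfFintype (Finset V)).toOuterMeasure E

/-- The conditional probability of `B` given `A` is at least `1 / 2` (or `A` has probability `0`),
for a seed set drawn uniformly from all subsets of `V`. -/
def HalfLikely {V : Type*} [Fintype V] [DecidableEq V] (A B : Set (Finset V)) : Prop :=
  1 / 2 * seedProb A ≤ seedProb (A ∩ B)

/-! The map S ↦ S* \ S is an involution of the seed sets satisfying the conditions and preserves C =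
S*, so it suffices that in each pair {S, C \ S} at least one sweep succeeds.

Divide PageRank by φ to get a density q, and let F(u,v) = φ(u) P(u,v), a circulation. The PageRank
equation becomes a resolvent equation for F with killing rate κ = 2α/(1-α). If a sweep fails at
level b, every strict proper superlevel set of q has conductance at least b. Cheeger's inequality
then bounds the energy of q below by b² Var q, and pairing the resolvent equation with q - 1 gives
D² Var q ≤ Var σ for D = b²/(2κ) (`IsResolvent.variance_le`). With b² = rα one gets D = r(1-α)/4, so
α nearly drops out.

Suppose both sweeps fail. PageRank is linear in its source, so the density from C is the
volume-weighted average of the two densities, and convexity gives D² vol(C) Var q ≤ 2. But α = Φ(C)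
is too large for the mass to leave C. If vol(C) ≤ 1/3, half of the mass stays on at most a third of
the volume (`IsResolvent.one_le_variance`). Near volume 1/2 this count gives nothing, and a cubic
test function takes over (`IsResolvent.variance_gt`). Both lower bounds contradict a large D.
Reversibility is never needed, because a circulation has equal flow into and out of every set. -/

/-- `F` is a nonnegative circulation on a finite vertex set, with throughput `φ`. -/
structure IsCirculation {V : Type*} [Fintype V] (F : V → V → ℝ) (φ : V → ℝ) : Prop where
  nonneg : ∀ u v, 0 ≤ F u v
  row_sum : ∀ u, ∑ v, F u v = φ u
  col_sum : ∀ v, ∑ u, F u v = φ v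

/-- The flow leaving a vertex set. -/
def outflow {V : Type*} [Fintype V] [DecidableEq V] (F : V → V → ℝ) (A : Finset V) : ℝ :=
  ∑ u ∈ A, ∑ v ∈ Aᶜ, F u v

/-- `q` is the density of the equilibrium of averaging along `F`, with source `κ σ` and
killing rate `κ`. -/
def IsResolvent {V : Type*} [Fintype V] (F : V → V → ℝ) (φ : V → ℝ) (κ : ℝ) (σ q : V → ℝ) : Prop :=
  ∀ v, ∑ u, F u v * (q u - q v) = κ * φ v * (q v - σ v)

/-! ### Circulations: flux, coarea and the one-sided Cheeger inequality -/

namespace IsCirculation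

variable {V : Type*} [Fintype V] {F : V → V → ℝ} {φ : V → ℝ}

theorem sum_mul_tail (hF : IsCirculation F φ) (f : V → ℝ) :
    ∑ u, ∑ v, F u v * f u = ∑ v, φ v * f v := by
  simp_rw [← Finset.sum_mul, hF.row_sum]

theorem sum_mul_head (hF : IsCirculation F φ) (f : V → ℝ) :
    ∑ u, ∑ v, F u v * f v = ∑ v, φ v * f v := by
  rw [Finset.sum_comm]
  simp_rw [← Finset.sum_mul, hF.col_sum]

theorem throughput_nonneg (hF : IsCirculation F φ) (v : V) : 0 ≤ φ v := by
  rw [← hF.row_sum v]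
  exact Finset.sum_nonneg fun u _ => hF.nonneg v u

theorem sum_sub_eq_zero (hF : IsCirculation F φ) (f : V → ℝ) :
    ∑ u, ∑ v, F u v * (f u - f v) = 0 := by
  simp_rw [mul_sub, Finset.sum_sub_distrib]
  rw [hF.sum_mul_tail, hF.sum_mul_head, sub_self]

theorem sum_abs_eq_two_mul_sum_posPart (hF : IsCirculation F φ) (f : V → ℝ) :
    ∑ u, ∑ v, F u v * |f u - f v| = 2 * ∑ u, ∑ v, F u v * max (f u - f v) 0 := by
  have h := hF.sum_sub_eq_zero f
  have h2 : ∑ u, ∑ v, F u v * |f u - f v|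
      = ∑ u, ∑ v, (2 * (F u v * max (f u - f v) 0) - F u v * (f u - f v)) := by
    refine Finset.sum_congr rfl fun u _ => Finset.sum_congr rfl fun v _ => ?_
    rcases le_total 0 (f u - f v) with h | h
    · rw [abs_of_nonneg h, max_eq_left h]; ring
    · rw [abs_of_nonpos h, max_eq_right h]; ring
  rw [h2]
  simp_rw [Finset.sum_sub_distrib, ← Finset.mul_sum]
  linarith

variable [DecidableEq V]

/-- Contributions of edges inside Cᶜ cancel; on boundary edges only the value at the tail survives.
-/
theorem sum_compl_flux (hF : IsCirculation F φ) (C : Finset V) (f : V → ℝ) :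
    ∑ v ∈ Cᶜ, ∑ u, F u v * (f u - f v)
      = ∑ u ∈ C, ∑ v ∈ Cᶜ, F u v * f u - ∑ u ∈ Cᶜ, ∑ v ∈ C, F u v * f u := by
  have h1 : ∑ v ∈ Cᶜ, ∑ u, F u v * (f u - f v)
      = ∑ u, ∑ v ∈ Cᶜ, F u v * f u - ∑ v ∈ Cᶜ, φ v * f v := by
    rw [Finset.sum_comm (s := Finset.univ), ← Finset.sum_sub_distrib]
    refine Finset.sum_congr rfl fun v _ => ?_
    simp_rw [mul_sub, Finset.sum_sub_distrib, ← Finset.sum_mul, hF.col_sum]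
  have h2 : ∑ v ∈ Cᶜ, φ v * f v
      = ∑ u ∈ Cᶜ, ∑ v ∈ C, F u v * f u + ∑ u ∈ Cᶜ, ∑ v ∈ Cᶜ, F u v * f u := by
    rw [← Finset.sum_add_distrib]
    refine Finset.sum_congr rfl fun u _ => ?_
    rw [Finset.sum_add_sum_compl, ← Finset.sum_mul, hF.row_sum]
  rw [h1, h2, ← Finset.sum_add_sum_compl C fun u => ∑ v ∈ Cᶜ, F u v * f u]
  ring

theorem outflow_compl (hF : IsCirculation F φ) (C : Finset V) : outflow F Cᶜ = outflow F C := by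
  have h := hF.sum_compl_flux C fun _ => 1
  simp only [sub_self, mul_zero, Finset.sum_const_zero, mul_one] at h
  rw [outflow, outflow, compl_compl]
  linarith

theorem outflow_nonneg (hF : IsCirculation F φ) (C : Finset V) : 0 ≤ outflow F C :=
  Finset.sum_nonneg fun u _ => Finset.sum_nonneg fun v _ => hF.nonneg u v

theorem outflow_le (hF : IsCirculation F φ) (C : Finset V) : outflow F C ≤ ∑ v ∈ C, φ v := by
  refine Finset.sum_le_sum fun u _ => ?_
  rw [← hF.row_sum u]
  exact Finset.sum_le_univ_sum_of_nonneg fun v => hF.nonneg u v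

/-- The flows in the two directions across the boundary are equal, so only the oscillation of f
counts. -/
theorem sum_compl_flux_le (hF : IsCirculation F φ) (C : Finset V) {f : V → ℝ} {lo hi : ℝ}
    (hlo : ∀ v, lo ≤ f v) (hhi : ∀ v, f v ≤ hi) :
    ∑ v ∈ Cᶜ, ∑ u, F u v * (f u - f v) ≤ (hi - lo) * outflow F C := by
  have h1 : ∑ u ∈ C, ∑ v ∈ Cᶜ, F u v * f u ≤ outflow F C * hi := by
    simp_rw [outflow, Finset.sum_mul]
    exact Finset.sum_le_sum fun u _ => Finset.sum_le_sum fun v _ =>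
      mul_le_mul_of_nonneg_left (hhi u) (hF.nonneg u v)
  have h2 : outflow F Cᶜ * lo ≤ ∑ u ∈ Cᶜ, ∑ v ∈ C, F u v * f u := by
    simp_rw [outflow, Finset.sum_mul, compl_compl]
    exact Finset.sum_le_sum fun u _ => Finset.sum_le_sum fun v _ =>
      mul_le_mul_of_nonneg_left (hlo u) (hF.nonneg u v)
  rw [hF.outflow_compl] at h2
  rw [hF.sum_compl_flux]
  linarith

/-- Coarea inequality: if all superlevel sets of `g ≥ 0` expand, the total variation of `g` is
large. -/
theorem coarea {θ : ℝ} {g : V → ℝ} (hg : ∀ v, 0 ≤ g v)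
    (hexp : ∀ A : Finset V, A.Nonempty → (∀ u ∈ A, 0 < g u) →
      (∀ u ∈ A, ∀ v ∉ A, g v < g u) → θ * ∑ v ∈ A, φ v ≤ outflow F A) :
    θ * ∑ v, φ v * g v ≤ ∑ u, ∑ v, F u v * max (g u - g v) 0 := by
  induction hn : (Finset.univ.filter fun v => 0 < g v).card using Nat.strong_induction_on
    generalizing g with
  | _ n ih =>
  set T := Finset.univ.filter fun v => 0 < g v with hT
  have memT : ∀ v, v ∈ T ↔ 0 < g v := fun v => by simp [hT]
  rcases T.eq_empty_or_nonempty with h0 | h0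
  · have : ∀ v, g v = 0 := fun v =>
      le_antisymm (not_lt.1 fun h => by simpa [h0] using (memT v).2 h) (hg v)
    simp [this]
  · obtain ⟨w, hwT, hw⟩ := T.exists_min_image g h0
    set m := g w with hm
    have hmpos : 0 < m := (memT w).1 hwT
    -- Peel off the lowest positive layer: g = g' + m on T. The minimizer w leaves the support, and
    -- the strict superlevel sets of g' in its support are also ones of g.
    set g' : V → ℝ := fun v => if v ∈ T then g v - m else 0 with hg'
    have hnT : ∀ v, v ∉ T → g v = 0 := fun v hv =>
      le_antisymm (not_lt.1 fun h => hv ((memT v).2 h)) (hg v)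
    have hg'0 : ∀ v, 0 ≤ g' v := fun v => by
      simp only [hg']
      split_ifs with h
      · linarith [hw v h]
      · rfl
    have hlt : (Finset.univ.filter fun v => 0 < g' v).card < n := by
      rw [← hn]
      refine Finset.card_lt_card (Finset.ssubset_iff_subset_ne.2 ⟨fun v hv => ?_, fun h => ?_⟩)
      · by_contra hvT
        simp [hg', hvT] at hv
      · rw [← h] at hwT
        simp [hg', (memT w).2 hmpos, ← hm] at hwT
    have key := ih _ hlt hg'0 (fun A hA hpos hsep => ?_) rfl
    · have hTexp := hexp T h0 (fun u hu => (memT u).1 hu) fun u hu v hv => by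
        rw [hnT v hv]; exact (memT u).1 hu
      have e1 : ∑ v, φ v * g v = ∑ v, φ v * g' v + m * ∑ v ∈ T, φ v := by
        rw [← Finset.sum_filter_add_sum_filter_not Finset.univ (· ∈ T) fun v => φ v * g v,
          ← Finset.sum_filter_add_sum_filter_not Finset.univ (· ∈ T) fun v => φ v * g' v]
        have a1 : ∑ v with v ∉ T, φ v * g v = 0 :=
          Finset.sum_eq_zero fun v hv => by rw [hnT v (by simpa using hv), mul_zero]
        have a2 : ∑ v with v ∉ T, φ v * g' v = 0 :=
          Finset.sum_eq_zero fun v hv => by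
            have : v ∉ T := by simpa using hv
            simp [hg', this]
        have a3 : (Finset.univ.filter fun v => v ∈ T) = T := by ext; simp
        rw [a1, a2, a3, Finset.mul_sum, add_zero, add_zero, ← Finset.sum_add_distrib]
        refine Finset.sum_congr rfl fun v hv => ?_
        simp only [hg', hv, if_true]; ring
      have e2 : ∑ u, ∑ v, F u v * max (g u - g v) 0
          = ∑ u, ∑ v, F u v * max (g' u - g' v) 0 + m * outflow F T := by
        have : m * outflow F T
            = ∑ u, ∑ v, F u v * (if u ∈ T then if v ∈ T then 0 else m else 0) := by
          rw [outflow, Finset.mul_sum, ← Finset.sum_subset (Finset.subset_univ T)]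
          · refine Finset.sum_congr rfl fun u hu => ?_
            rw [Finset.mul_sum, ← Finset.sum_subset (Finset.subset_univ Tᶜ)]
            · refine Finset.sum_congr rfl fun v hv => ?_
              have : v ∉ T := Finset.mem_compl.1 hv
              simp [hu, this, mul_comm]
            · intro v _ hv
              have : v ∈ T := by simpa using hv
              simp [this]
          · intro u _ hu
            simp [hu]
        rw [this, ← Finset.sum_add_distrib]
        refine Finset.sum_congr rfl fun u _ => ?_
        rw [← Finset.sum_add_distrib]
        refine Finset.sum_congr rfl fun v _ => ?_
        rw [← mul_add]
        congr 1
        by_cases hu : u ∈ T <;> by_cases hv : v ∈ T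
        · simp [hg', hu, hv]
        · have h1 : (0 : ℝ) ≤ g u - m := sub_nonneg.2 (hw u hu)
          simp [hg', hu, hv, hnT v hv, hg u, hw u hu]
        · have h1 : (0 : ℝ) ≤ g v - m := sub_nonneg.2 (hw v hv)
          simp [hg', hu, hv, hnT u hu, hg v, hw v hv]
        · simp [hg', hu, hv, hnT u hu, hnT v hv]
      rw [e1, e2]
      have := mul_le_mul_of_nonneg_left hTexp hmpos.le
      linarith
    · have hAT : ∀ u ∈ A, u ∈ T ∧ 0 < g u - m := fun u hu => by
        have := hpos u hu
        by_cases huT : u ∈ T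
        · simp only [hg', huT, if_true] at this
          exact ⟨huT, this⟩
        · simp [hg', huT] at this
      refine hexp A hA (fun u hu => (memT u).1 (hAT u hu).1) fun u hu v hv => ?_
      by_cases hvT : v ∈ T
      · have := hsep u hu v hv
        simp only [hg', hvT, (hAT u hu).1, if_true] at this
        linarith
      · rw [hnT v hvT]; exact (memT u).1 (hAT u hu).1

/-- The Cheeger inequality for one nonnegative function. -/
theorem cheeger_of_nonneg (hF : IsCirculation F φ) {θ : ℝ} (hθ : 0 < θ) {f : V → ℝ}
    (hf : ∀ v, 0 ≤ f v)
    (hexp : ∀ A : Finset V, A.Nonempty → (∀ u ∈ A, 0 < f u) →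
      (∀ u ∈ A, ∀ v ∉ A, f v < f u) → θ * ∑ v ∈ A, φ v ≤ outflow F A) :
    θ ^ 2 * ∑ v, φ v * f v ^ 2 ≤ ∑ u, ∑ v, F u v * (f u - f v) ^ 2 := by
  have h1 := coarea (F := F) (φ := φ) (θ := θ) (g := fun v => f v ^ 2) (fun v => sq_nonneg _)
    fun A hA hpos hsep => hexp A hA
      (fun u hu => (hf u).lt_of_ne fun h => by simpa [← h] using hpos u hu)
      fun u hu v hv => lt_of_pow_lt_pow_left₀ 2 (hf u) (hsep u hu v hv)
  have h2 := hF.sum_abs_eq_two_mul_sum_posPart fun v => f v ^ 2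
  have h3 : ∑ u, ∑ v, F u v * |f u ^ 2 - f v ^ 2|
      ≤ ∑ u, ∑ v, (θ⁻¹ * (F u v * (f u - f v) ^ 2)
        + θ / 2 * (F u v * f u ^ 2) + θ / 2 * (F u v * f v ^ 2)) := by
    refine Finset.sum_le_sum fun u _ => Finset.sum_le_sum fun v _ => ?_
    -- AM-GM balanced so that the last two terms sum to θ ∑ φ f², half of the 2θ ∑ φ f² that coarea
    -- provides.
    have : |f u ^ 2 - f v ^ 2| ≤ θ⁻¹ * (f u - f v) ^ 2 + θ / 2 * f u ^ 2 + θ / 2 * f v ^ 2 := by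
      have e : f u ^ 2 - f v ^ 2 = (f u - f v) * (f u + f v) := by ring
      rw [e, abs_mul, abs_of_nonneg (add_nonneg (hf u) (hf v)), ← sq_abs (f u - f v)]
      set d := |f u - f v|
      have hd : d ^ 2 = (f u - f v) ^ 2 := sq_abs _
      have h4 : 0 ≤ θ⁻¹ * (d - θ / 2 * (f u + f v)) ^ 2 := by positivity
      have h5 : θ⁻¹ * (d - θ / 2 * (f u + f v)) ^ 2
          = θ⁻¹ * d ^ 2 - d * (f u + f v) + θ / 4 * (f u + f v) ^ 2 := by
        field_simp
        ring
      have h6 : θ / 4 * (f u + f v) ^ 2 ≤ θ / 2 * f u ^ 2 + θ / 2 * f v ^ 2 := by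
        nlinarith [mul_nonneg hθ.le (sq_nonneg (f u - f v))]
      linarith
    calc F u v * |f u ^ 2 - f v ^ 2|
        ≤ F u v * (θ⁻¹ * (f u - f v) ^ 2 + θ / 2 * f u ^ 2 + θ / 2 * f v ^ 2) :=
          mul_le_mul_of_nonneg_left this (hF.nonneg u v)
      _ = _ := by ring
  simp_rw [Finset.sum_add_distrib, ← Finset.mul_sum] at h3
  rw [hF.sum_mul_tail fun v => f v ^ 2, hF.sum_mul_head fun v => f v ^ 2] at h3
  set X := ∑ v, φ v * f v ^ 2
  set Y := ∑ u, ∑ v, F u v * (f u - f v) ^ 2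
  have h7 : θ * X ≤ θ⁻¹ * Y := by linarith
  calc θ ^ 2 * X = θ * (θ * X) := by ring
    _ ≤ θ * (θ⁻¹ * Y) := mul_le_mul_of_nonneg_left h7 hθ.le
    _ = Y := by field_simp

end IsCirculation

/-! ### Medians and the two-sided Cheeger inequality -/

/-- Every function has a median. -/
theorem exists_median {V : Type*} [Fintype V] [Nonempty V] {φ : V → ℝ} (hφ : ∀ v, 0 ≤ φ v)
    (hsum : ∑ v, φ v = 1) (q : V → ℝ) :
    ∃ m, (∑ v with m < q v, φ v) ≤ 1 / 2 ∧ (∑ v with q v < m, φ v) ≤ 1 / 2 := by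
  classical
  -- The least value with at most half of the volume above it is a median: the next smaller value
  -- has more than half above it.
  set T := Finset.univ.filter fun w => (∑ v with q w < q v, φ v) ≤ 1 / 2 with hT
  obtain ⟨w₀, -, hw₀⟩ := Finset.univ.exists_max_image q Finset.univ_nonempty
  have hne : T.Nonempty := ⟨w₀, by
    have : (Finset.univ.filter fun v => q w₀ < q v) = ∅ := by
      ext v; simpa using hw₀ v (Finset.mem_univ v)
    simp [hT, this]⟩
  obtain ⟨w, hwT, hw⟩ := T.exists_min_image q hne
  refine ⟨q w, by simpa [hT] using hwT, ?_⟩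
  rcases (Finset.univ.filter fun v => q v < q w).eq_empty_or_nonempty with h0 | h0
  · rw [h0]; norm_num
  · obtain ⟨z, hz, hzmax⟩ := Finset.exists_max_image _ q h0
    have hzw : q z < q w := by simpa using hz
    have hzT : ¬ (∑ v with q z < q v, φ v) ≤ 1 / 2 := fun h =>
      absurd (hw z (by simpa [hT] using h)) (not_le.2 hzw)
    have hsub : (Finset.univ.filter fun v => q v < q w) ⊆
        Finset.univ.filter fun v => ¬ q z < q v := fun v hv => by
      simpa using hzmax v hv
    have h1 := Finset.sum_le_sum_of_subset_of_nonneg hsub (f := φ) fun v _ _ => hφ v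
    have h2 := Finset.sum_filter_add_sum_filter_not Finset.univ (fun v => q z < q v) φ
    rw [hsum] at h2
    push Not at hzT
    linarith

namespace IsCirculation

variable {V : Type*} [Fintype V] [DecidableEq V] {F : V → V → ℝ} {φ : V → ℝ}

/-- The Cheeger inequality, where only the strict superlevel sets of `q` are known to expand. -/
theorem cheeger (hF : IsCirculation F φ) (hsum : ∑ v, φ v = 1) {θ : ℝ} (hθ : 0 < θ) {q : V → ℝ}
    (hq : ∑ v, φ v * q v = 1)
    (hexp : ∀ A : Finset V, A.Nonempty → A ≠ Finset.univ → (∀ u ∈ A, ∀ v ∉ A, q v < q u) →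
      θ * min (∑ v ∈ A, φ v) (1 - ∑ v ∈ A, φ v) ≤ outflow F A) :
    θ ^ 2 * ∑ v, φ v * (q v - 1) ^ 2 ≤ ∑ u, ∑ v, F u v * (q u - q v) ^ 2 := by
  have hφ := hF.throughput_nonneg
  have : Nonempty V := by
    by_contra h
    rw [not_nonempty_iff] at h
    simp at hsum
  -- Cutting at a median keeps the level sets of both parts at volume at most 1/2, where the minimum
  -- in `hexp` is known.
  obtain ⟨m, hm1, hm2⟩ := exists_median hφ hsum q
  have hproper : ∀ A : Finset V, (∑ v ∈ A, φ v) ≤ 1 / 2 → A ≠ Finset.univ := by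
    rintro A hA rfl
    rw [hsum] at hA
    norm_num at hA
  have hup := hF.cheeger_of_nonneg hθ (f := fun v => max (q v - m) 0) (fun v => le_max_right _ _)
    fun A hA hpos hsep => by
      have hposm : ∀ u ∈ A, m < q u := fun u hu => by simpa using hpos u hu
      have hvol : (∑ v ∈ A, φ v) ≤ 1 / 2 :=
        (Finset.sum_le_sum_of_subset_of_nonneg
          (fun u hu => by simpa using hposm u hu) fun v _ _ => hφ v).trans hm1
      have := hexp A hA (hproper A hvol) fun u hu v hv => by
        by_contra h
        exact absurd (hsep u hu v hv) (not_lt.2 (max_le_max (by linarith) le_rfl))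
      rwa [min_eq_left (by linarith)] at this
  have hdown := hF.cheeger_of_nonneg hθ (f := fun v => max (m - q v) 0) (fun v => le_max_right _ _)
    fun A hA hpos hsep => by
      have hposm : ∀ u ∈ A, q u < m := fun u hu => by simpa using hpos u hu
      have hvol : (∑ v ∈ A, φ v) ≤ 1 / 2 :=
        (Finset.sum_le_sum_of_subset_of_nonneg
          (fun u hu => by simpa using hposm u hu) fun v _ _ => hφ v).trans hm2
      have hc : ∑ v ∈ Aᶜ, φ v = 1 - ∑ v ∈ A, φ v := by
        rw [← hsum, ← Finset.sum_add_sum_compl A φ]; ring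
      have hAc : Aᶜ ≠ Finset.univ := by
        rw [Ne, Finset.compl_eq_univ_iff]; exact hA.ne_empty
      have hne : Aᶜ.Nonempty := by
        rw [Finset.nonempty_iff_ne_empty, Ne, Finset.compl_eq_empty_iff]
        exact hproper A hvol
      -- A is a sublevel set of q; its complement is a superlevel set with the same outflow.
      have := hexp Aᶜ hne hAc fun u hu v hv => by
        by_contra h
        rw [Finset.mem_compl] at hu
        rw [Finset.mem_compl, not_not] at hv
        exact absurd (hsep v hv u hu) (not_lt.2 (max_le_max (by linarith) le_rfl))
      rw [hF.outflow_compl, hc, min_eq_right (by linarith)] at this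
      linarith
  have hsplit : ∑ u, ∑ v, F u v * (max (q u - m) 0 - max (q v - m) 0) ^ 2
      + ∑ u, ∑ v, F u v * (max (m - q u) 0 - max (m - q v) 0) ^ 2
      ≤ ∑ u, ∑ v, F u v * (q u - q v) ^ 2 := by
    simp_rw [← Finset.sum_add_distrib]
    refine Finset.sum_le_sum fun u _ => Finset.sum_le_sum fun v _ => ?_
    rw [← mul_add]
    refine mul_le_mul_of_nonneg_left ?_ (hF.nonneg u v)
    rcases le_total (q u) m with h1 | h1 <;> rcases le_total (q v) m with h2 | h2
    · rw [max_eq_right (by linarith), max_eq_right (by linarith), max_eq_left (by linarith),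
        max_eq_left (by linarith)]
      exact le_of_eq (by ring)
    · rw [max_eq_right (by linarith), max_eq_left (by linarith), max_eq_left (by linarith),
        max_eq_right (by linarith)]
      nlinarith
    · rw [max_eq_left (by linarith), max_eq_right (by linarith), max_eq_right (by linarith),
        max_eq_left (by linarith)]
      nlinarith
    · rw [max_eq_left (by linarith), max_eq_left (by linarith), max_eq_right (by linarith),
        max_eq_right (by linarith)]
      exact le_of_eq (by ring)
  -- The second moment about m exceeds the variance by (1 - m)².
  have hvar : ∑ v, φ v * (q v - 1) ^ 2
      ≤ ∑ v, φ v * max (q v - m) 0 ^ 2 + ∑ v, φ v * max (m - q v) 0 ^ 2 := by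
    have e1 : ∑ v, φ v * max (q v - m) 0 ^ 2 + ∑ v, φ v * max (m - q v) 0 ^ 2
        = ∑ v, (φ v * (q v - 1) ^ 2 + 2 * (1 - m) * (φ v * q v)
          + ((1 - m) ^ 2 - 2 * (1 - m)) * φ v) := by
      rw [← Finset.sum_add_distrib]
      refine Finset.sum_congr rfl fun v _ => ?_
      rcases le_total (q v) m with h1 | h1
      · rw [max_eq_right (by linarith), max_eq_left (by linarith)]; ring
      · rw [max_eq_left (by linarith), max_eq_right (by linarith)]; ring
    rw [e1]
    simp_rw [Finset.sum_add_distrib, ← Finset.mul_sum]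
    rw [hq, hsum]
    nlinarith [sq_nonneg (1 - m)]
  have := mul_le_mul_of_nonneg_left hvar (sq_nonneg θ)
  linarith

end IsCirculation

/-! ### Resolvent densities: maximum principle, energy and variance -/

namespace IsResolvent

variable {V : Type*} [Fintype V] {F : V → V → ℝ} {φ σ q : V → ℝ} {κ : ℝ}

theorem sum_eq (h : IsResolvent F φ κ σ q) (hF : IsCirculation F φ) (hκ : κ ≠ 0) :
    ∑ v, φ v * q v = ∑ v, φ v * σ v := by
  have h1 := hF.sum_sub_eq_zero q
  rw [Finset.sum_comm] at h1
  simp_rw [h _] at h1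
  have h2 : ∑ v, κ * φ v * (q v - σ v) = κ * (∑ v, φ v * q v - ∑ v, φ v * σ v) := by
    rw [← Finset.sum_sub_distrib, Finset.mul_sum]
    exact Finset.sum_congr rfl fun v _ => by ring
  rw [h2] at h1
  exact sub_eq_zero.1 ((mul_eq_zero.1 h1).resolve_left hκ)

/-- Maximum principle: at a maximum of q the left side of the equation is nonpositive, so q cannot
exceed the source there. -/
theorem le_of_source_le [Nonempty V] (h : IsResolvent F φ κ σ q) (hF : IsCirculation F φ)
    (hκ : 0 < κ) (hφ : ∀ v, 0 < φ v) {B : ℝ} (hσ : ∀ v, σ v ≤ B) (v : V) : q v ≤ B := by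
  obtain ⟨w, -, hw⟩ := Finset.univ.exists_max_image q Finset.univ_nonempty
  refine (hw v (Finset.mem_univ v)).trans ?_
  by_contra! hB
  have h1 := h w
  have h2 : ∑ u, F u w * (q u - q w) ≤ 0 := Finset.sum_nonpos fun u _ =>
    mul_nonpos_of_nonneg_of_nonpos (hF.nonneg u w) (by linarith [hw u (Finset.mem_univ u)])
  have h3 : 0 < κ * φ w * (q w - σ w) :=
    mul_pos (mul_pos hκ (hφ w)) (by linarith [hσ w])
  linarith

theorem neg (h : IsResolvent F φ κ σ q) : IsResolvent F φ κ (fun v => -σ v) fun v => -q v := by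
  intro v
  have h1 : ∑ u, F u v * (-q u - -q v) = -∑ u, F u v * (q u - q v) := by
    rw [← Finset.sum_neg_distrib]
    exact Finset.sum_congr rfl fun u _ => by ring
  rw [h1, h v]; ring

theorem nonneg [Nonempty V] (h : IsResolvent F φ κ σ q) (hF : IsCirculation F φ)
    (hκ : 0 < κ) (hφ : ∀ v, 0 < φ v) (hσ : ∀ v, 0 ≤ σ v) (v : V) : 0 ≤ q v := by
  have := h.neg.le_of_source_le hF hκ hφ (B := 0) (fun v => by simpa using hσ v) v
  simpa using this

/-- Pair the equation with q - 1. The differences of (q - 1)² sum to zero along a circulation, which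
replaces symmetry of F. -/
theorem energy_eq (h : IsResolvent F φ κ σ q) (hF : IsCirculation F φ) :
    ∑ u, ∑ v, F u v * (q u - q v) ^ 2 = 2 * κ * ∑ v, φ v * ((q v - 1) * (σ v - q v)) := by
  have h1 := hF.sum_sub_eq_zero fun v => (q v - 1) ^ 2
  have h2 : ∑ u, ∑ v, F u v * (q u - q v) ^ 2
      = ∑ u, ∑ v, (F u v * ((q u - 1) ^ 2 - (q v - 1) ^ 2)
        + -2 * (F u v * (q u - q v) * (q v - 1))) :=
    Finset.sum_congr rfl fun u _ => Finset.sum_congr rfl fun v _ => by ring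
  simp_rw [Finset.sum_add_distrib, ← Finset.mul_sum] at h2
  rw [h1, Finset.sum_comm (f := fun u v => F u v * (q u - q v) * (q v - 1))] at h2
  simp_rw [← Finset.sum_mul, h _] at h2
  rw [h2, zero_add, Finset.mul_sum, Finset.mul_sum]
  exact Finset.sum_congr rfl fun v _ => by ring

theorem energy_add_variance_eq (h : IsResolvent F φ κ σ q) (hF : IsCirculation F φ) :
    ∑ u, ∑ v, F u v * (q u - q v) ^ 2 + 2 * κ * ∑ v, φ v * (q v - 1) ^ 2
      = 2 * κ * ∑ v, φ v * ((q v - 1) * (σ v - 1)) := by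
  rw [h.energy_eq hF, ← mul_add, ← Finset.sum_add_distrib]
  congr 1
  exact Finset.sum_congr rfl fun v _ => by ring

variable [DecidableEq V]

/-- If the superlevel sets of the resolvent density expand, the density is close to `1`. -/
theorem variance_le (h : IsResolvent F φ κ σ q) (hF : IsCirculation F φ) (hκ : 0 < κ)
    (hsum : ∑ v, φ v = 1) (hσ : ∑ v, φ v * σ v = 1) {θ : ℝ} (hθ : 0 < θ)
    (hexp : ∀ A : Finset V, A.Nonempty → A ≠ Finset.univ → (∀ u ∈ A, ∀ v ∉ A, q v < q u) →
      θ * min (∑ v ∈ A, φ v) (1 - ∑ v ∈ A, φ v) ≤ outflow F A) :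
    (θ ^ 2 / (2 * κ)) ^ 2 * ∑ v, φ v * (q v - 1) ^ 2 ≤ ∑ v, φ v * (σ v - 1) ^ 2 := by
  have hφ := hF.throughput_nonneg
  have h1 := hF.cheeger hsum hθ ((h.sum_eq hF hκ.ne').trans hσ) hexp
  have h2 := h.energy_add_variance_eq hF
  set X := ∑ v, φ v * (q v - 1) ^ 2
  have hX : 0 ≤ X := Finset.sum_nonneg fun v _ => mul_nonneg (hφ v) (sq_nonneg _)
  set D := θ ^ 2 / (2 * κ) with hD
  have hD0 : 0 ≤ D := by positivity
  have h3 : D * X ≤ ∑ v, φ v * ((q v - 1) * (σ v - 1)) := by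
    rw [hD, div_mul_eq_mul_div, div_le_iff₀ (by positivity)]
    nlinarith [mul_nonneg hκ.le hX]
  -- Expanding this square plays the role of Cauchy-Schwarz and avoids dividing by the variance.
  have h4 : 0 ≤ ∑ v, φ v * (D * (q v - 1) - (σ v - 1)) ^ 2 :=
    Finset.sum_nonneg fun v _ => mul_nonneg (hφ v) (sq_nonneg _)
  have h5 : ∑ v, φ v * (D * (q v - 1) - (σ v - 1)) ^ 2
      = D ^ 2 * X - 2 * D * ∑ v, φ v * ((q v - 1) * (σ v - 1)) + ∑ v, φ v * (σ v - 1) ^ 2 := by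
    simp only [X, Finset.mul_sum]
    rw [← Finset.sum_sub_distrib, ← Finset.sum_add_distrib]
    exact Finset.sum_congr rfl fun v _ => by ring
  nlinarith [mul_le_mul_of_nonneg_left h3 hD0]

/-- No source lies outside C, so the mass killed there equals the net flux into Cᶜ. -/
theorem sum_compl_le (h : IsResolvent F φ κ σ q) (hF : IsCirculation F φ) {C : Finset V}
    (hσ : ∀ v ∉ C, σ v = 0) {B : ℝ} (hq0 : ∀ v, 0 ≤ q v) (hqB : ∀ v, q v ≤ B) :
    κ * ∑ v ∈ Cᶜ, φ v * q v ≤ B * outflow F C := by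
  have h1 := hF.sum_compl_flux_le C hq0 hqB
  have h2 : ∑ v ∈ Cᶜ, ∑ u, F u v * (q u - q v) = κ * ∑ v ∈ Cᶜ, φ v * q v := by
    rw [Finset.mul_sum]
    refine Finset.sum_congr rfl fun v hv => ?_
    rw [h v, hσ v (Finset.mem_compl.1 hv)]; ring
  rw [h2, sub_zero] at h1
  exact h1

/-- A resolvent density whose source is uniform on a set of volume at most `1 / 3` and which leaks
at most half of its mass is far from `1`. -/
theorem one_le_variance (hF : IsCirculation F φ) (hsum : ∑ v, φ v = 1)
    {C : Finset V} (hC : 0 < ∑ v ∈ C, φ v) (hC3 : ∑ v ∈ C, φ v ≤ 1 / 3)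
    (hσ : ∀ v, σ v = if v ∈ C then (∑ v ∈ C, φ v)⁻¹ else 0)
    (h : IsResolvent F φ κ σ q) (hκ : 0 < κ) (hφ : ∀ v, 0 < φ v)
    (hout : 2 * outflow F C ≤ κ * ∑ v ∈ C, φ v) :
    1 ≤ 36 * ((∑ v ∈ C, φ v) * ∑ v, φ v * (q v - 1) ^ 2) := by
  have : Nonempty V := by
    by_contra h
    rw [not_nonempty_iff] at h
    simp at hsum
  set c := ∑ v ∈ C, φ v with hc
  have hσ0 : ∀ v, 0 ≤ σ v := fun v => by
    rw [hσ]; split_ifs <;> positivity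
  have hσB : ∀ v, σ v ≤ c⁻¹ := fun v => by
    rw [hσ]; split_ifs
    · rfl
    · positivity
  have h1 := h.sum_compl_le hF (C := C) (fun v hv => by simp [hσ, hv])
    (h.nonneg hF hκ hφ hσ0) (h.le_of_source_le hF hκ hφ hσB)
  have h2 : ∑ v ∈ Cᶜ, φ v * q v ≤ 1 / 2 := by
    have : c⁻¹ * outflow F C ≤ κ / 2 := by
      rw [inv_mul_le_iff₀ hC]; linarith
    nlinarith
  have h3 : ∑ v, φ v * q v = 1 := by
    rw [h.sum_eq hF hκ.ne']
    simp_rw [hσ, mul_ite, mul_zero]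
    rw [Finset.sum_ite_mem, Finset.univ_inter, ← Finset.sum_mul]
    exact mul_inv_cancel₀ hC.ne'
  rw [← Finset.sum_add_sum_compl C] at h3
  have h4 : ∑ v ∈ C, φ v * (q v - 1) = ∑ v ∈ C, φ v * q v - c := by
    rw [hc, ← Finset.sum_sub_distrib]
    exact Finset.sum_congr rfl fun v _ => by ring
  -- Mass at least 1/2 on volume at most 1/3.
  have h5 : 1 / 6 ≤ ∑ v ∈ C, φ v * (q v - 1) := by linarith
  have h6 : (∑ v ∈ C, φ v * (q v - 1)) ^ 2 ≤ c * ∑ v ∈ C, φ v * (q v - 1) ^ 2 :=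
    Finset.sum_sq_le_sum_mul_sum_of_sq_le_mul C (fun v _ => (hφ v).le)
      (fun v _ => mul_nonneg (hφ v).le (sq_nonneg _)) fun v _ => le_of_eq (by ring)
  have h7 : ∑ v ∈ C, φ v * (q v - 1) ^ 2 ≤ ∑ v, φ v * (q v - 1) ^ 2 :=
    Finset.sum_le_univ_sum_of_nonneg fun v => mul_nonneg (hφ v).le (sq_nonneg _)
  have h8 := mul_le_mul_of_nonneg_left h7 hC.le
  nlinarith

/-- A resolvent density whose source is uniform on a set with volume between `1 / 3` and `1 / 2`
and with small outflow is far from `1`. Testing with the derivative of the cubic `y - y ^ 3 / 3`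
keeps the flux through the boundary small for directed flows as well. -/
theorem variance_gt (hF : IsCirculation F φ) (hsum : ∑ v, φ v = 1)
    {C : Finset V} (hC3 : 1 / 3 ≤ ∑ v ∈ C, φ v) (hC2 : ∑ v ∈ C, φ v ≤ 1 / 2)
    (hσ : ∀ v, σ v = if v ∈ C then (∑ v ∈ C, φ v)⁻¹ else 0)
    (h : IsResolvent F φ κ σ q) (hκ : 0 < κ) (hφ : ∀ v, 0 < φ v)
    (hout : 2 * outflow F C ≤ κ * ∑ v ∈ C, φ v) :
    1 / 10000 < ∑ v, φ v * (q v - 1) ^ 2 := by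
  have : Nonempty V := by
    by_contra h
    rw [not_nonempty_iff] at h
    simp at hsum
  by_contra! hV
  set c := ∑ v ∈ C, φ v with hc
  set X := ∑ v, φ v * (q v - 1) ^ 2 with hX
  have hcpos : 0 < c := by linarith
  have hcinv : c⁻¹ ≤ 3 := by
    rw [inv_le_comm₀ hcpos (by norm_num)]; linarith
  have hσ0 : ∀ v, 0 ≤ σ v := fun v => by
    rw [hσ]; split_ifs <;> positivity
  have hσB : ∀ v, σ v ≤ 3 := fun v => by
    rw [hσ]; split_ifs
    · exact hcinv
    · norm_num
  have hq0 := h.nonneg hF hκ hφ hσ0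
  have hq3 := h.le_of_source_le hF hκ hφ hσB
  -- Small variance forces small energy.
  have henergy : ∑ u, ∑ v, F u v * (q u - q v) ^ 2 ≤ κ * (1 / 25) := by
    have h1 := h.energy_add_variance_eq hF
    have hX0 : 0 ≤ X := Finset.sum_nonneg fun v _ => mul_nonneg (hφ v).le (sq_nonneg _)
    have h2 : ∑ v, φ v * ((q v - 1) * (σ v - 1))
        ≤ ∑ v, (50 * (φ v * (q v - 1) ^ 2) + 1 / 200 * (φ v * (σ v * σ v) + φ v - 2 * (φ v * σ v))) := by
      refine Finset.sum_le_sum fun v _ => ?_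
      nlinarith [mul_nonneg (hφ v).le (sq_nonneg (100 * (q v - 1) - (σ v - 1)))]
    simp_rw [Finset.sum_add_distrib, ← Finset.mul_sum, Finset.sum_sub_distrib,
      Finset.sum_add_distrib, ← Finset.mul_sum] at h2
    have h3 : ∑ v, φ v * σ v = 1 := by
      simp_rw [hσ, mul_ite, mul_zero]
      rw [Finset.sum_ite_mem, Finset.univ_inter, ← Finset.sum_mul]
      exact mul_inv_cancel₀ hcpos.ne'
    have h4 : ∑ v, φ v * (σ v * σ v) ≤ 3 := by
      calc ∑ v, φ v * (σ v * σ v) ≤ ∑ v, φ v * σ v * 3 := Finset.sum_le_sum fun v _ => by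
            rw [← mul_assoc]
            exact mul_le_mul_of_nonneg_left (hσB v) (mul_nonneg (hφ v).le (hσ0 v))
        _ = 3 := by rw [← Finset.sum_mul, h3, one_mul]
    rw [h3, hsum] at h2
    have h5 : ∑ v, φ v * ((q v - 1) * (σ v - 1)) ≤ 1 / 50 := by linarith
    nlinarith [mul_nonneg hκ.le hX0]
  -- For y = q - 1 in [-1, 2] the cubic stays in [-2/3, 2/3]: oscillation 4/3, against the bound 3
  -- for q itself.
  have hflux : ∑ v ∈ Cᶜ, ∑ u, F u v * (((q u - 1) - (q u - 1) ^ 3 / 3)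
      - ((q v - 1) - (q v - 1) ^ 3 / 3)) ≤ (2 / 3 - -(2 / 3)) * outflow F C :=
    hF.sum_compl_flux_le C (f := fun v => (q v - 1) - (q v - 1) ^ 3 / 3)
      (fun v => by nlinarith [mul_nonneg (sub_nonneg.2 (hq3 v)) (sq_nonneg (q v))])
      (fun v => by nlinarith [mul_nonneg (by linarith [hq0 v] : 0 ≤ q v + 1) (sq_nonneg (q v - 2))])
  have htest : κ * ∑ v ∈ Cᶜ, φ v * (q v * (1 - (q v - 1) ^ 2))
      ≤ ∑ v ∈ Cᶜ, ∑ u, F u v * (((q u - 1) - (q u - 1) ^ 3 / 3) - ((q v - 1) - (q v - 1) ^ 3 / 3))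
        + 2 * ∑ u, ∑ v, F u v * (q u - q v) ^ 2 := by
    have e1 : κ * ∑ v ∈ Cᶜ, φ v * (q v * (1 - (q v - 1) ^ 2))
        = ∑ v ∈ Cᶜ, ∑ u, F u v * (q u - q v) * (1 - (q v - 1) ^ 2) := by
      rw [Finset.mul_sum]
      refine Finset.sum_congr rfl fun v hv => ?_
      rw [← Finset.sum_mul, h v, hσ v, if_neg (Finset.mem_compl.1 hv)]
      ring
    have e2 : ∑ v ∈ Cᶜ, ∑ u, F u v * (q u - q v) ^ 2 ≤ ∑ u, ∑ v, F u v * (q u - q v) ^ 2 := by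
      rw [Finset.sum_comm (f := fun u v => F u v * (q u - q v) ^ 2)]
      exact Finset.sum_le_univ_sum_of_nonneg fun v => Finset.sum_nonneg fun u _ =>
        mul_nonneg (hF.nonneg u v) (sq_nonneg _)
    have e3 : ∑ v ∈ Cᶜ, ∑ u, F u v * (q u - q v) * (1 - (q v - 1) ^ 2)
        ≤ ∑ v ∈ Cᶜ, ∑ u, (F u v * (((q u - 1) - (q u - 1) ^ 3 / 3)
          - ((q v - 1) - (q v - 1) ^ 3 / 3)) + 2 * (F u v * (q u - q v) ^ 2)) := by
      refine Finset.sum_le_sum fun v _ => Finset.sum_le_sum fun u _ => ?_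
      -- The Taylor remainder of the cubic is (q u - q v)² (q u + 2 q v - 3) / 3, at most 2 (q u - q
      -- v)² as q ≤ 3.
      have : 0 ≤ F u v * ((q u - q v) ^ 2 * (9 - q u - 2 * q v)) :=
        mul_nonneg (hF.nonneg u v) (mul_nonneg (sq_nonneg _) (by linarith [hq3 u, hq3 v]))
      linear_combination this / 3
    simp_rw [Finset.sum_add_distrib, ← Finset.mul_sum] at e3
    linarith
  have hmain : 1 - c - 1 / 100 - 3 / 10000 ≤ ∑ v ∈ Cᶜ, φ v * (q v * (1 - (q v - 1) ^ 2)) := by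
    have e1 : ∑ v ∈ Cᶜ, (φ v * (1 - 1 / 200) - 53 * (φ v * (q v - 1) ^ 2))
        ≤ ∑ v ∈ Cᶜ, φ v * (q v * (1 - (q v - 1) ^ 2)) := by
      refine Finset.sum_le_sum fun v _ => ?_
      have h1 : 0 ≤ φ v * (q v - 1 + 1 / 100) ^ 2 := mul_nonneg (hφ v).le (sq_nonneg _)
      have h2 : 0 ≤ φ v * ((q v - 1) ^ 2 * (3 - q v)) :=
        mul_nonneg (hφ v).le (mul_nonneg (sq_nonneg _) (by linarith [hq3 v]))
      linear_combination 50 * h1 + h2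
    rw [Finset.sum_sub_distrib, ← Finset.sum_mul, ← Finset.mul_sum] at e1
    have e2 : ∑ v ∈ Cᶜ, φ v * (q v - 1) ^ 2 ≤ X :=
      Finset.sum_le_univ_sum_of_nonneg fun v => mul_nonneg (hφ v).le (sq_nonneg _)
    have e3 : ∑ v ∈ Cᶜ, φ v = 1 - c := by
      rw [← hsum, ← Finset.sum_add_sum_compl C φ]; ring
    rw [e3] at e1
    linarith
  -- In units of κ: the left side of `htest` is at least 1/2 - 0.0103, the right side at most 2c/3 +
  -- 2/25 ≤ 0.414.
  have := mul_le_mul_of_nonneg_left hmain hκ.le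
  nlinarith

end IsResolvent

/-! ### The stationary flow and conductance -/

namespace WeightedGraphWalk

variable {V : Type*} [Fintype V] [DecidableEq V] (G : WeightedGraphWalk V)

/-- The stationary flow along the edges. -/
def flow (u v : V) : ℝ := G.φ u * G.P u v

theorem isCirculation_flow : IsCirculation G.flow G.φ where
  nonneg u v := mul_nonneg (G.φ_pos u).le (Matrix.nonneg_of_mem_rowStochastic G.stochastic)
  row_sum u := by
    simp_rw [flow, ← Finset.mul_sum, Matrix.sum_row_of_mem_rowStochastic G.stochastic, mul_one]
  col_sum v := by
    have := congrFun G.φ_stationary v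
    simpa [Matrix.vecMul, dotProduct, flow] using this

theorem boundary_eq (S : Finset V) : G.boundary S = outflow G.flow S := rfl

theorem vol_pos {S : Finset V} (hS : S.Nonempty) : 0 < G.vol S :=
  Finset.sum_pos (fun v _ => G.φ_pos v) hS

theorem vol_compl (S : Finset V) : G.vol Sᶜ = 1 - G.vol S := by
  rw [← G.φ_sum, ← Finset.sum_add_sum_compl S G.φ]
  simp [vol]

theorem min_vol_pos {S : Finset V} (hS : S.Nonempty) (hS' : S ≠ Finset.univ) :
    0 < min (G.vol S) (1 - G.vol S) := by
  refine lt_min (G.vol_pos hS) ?_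
  rw [← vol_compl]
  refine G.vol_pos ?_
  rwa [Finset.nonempty_iff_ne_empty, Ne, Finset.compl_eq_empty_iff]

theorem conductance_le_one {S : Finset V} (hS : S.Nonempty) (hS' : S ≠ Finset.univ) :
    G.conductance S ≤ 1 := by
  rw [conductance, div_le_one (G.min_vol_pos hS hS'), boundary_eq]
  refine le_min (G.isCirculation_flow.outflow_le S) ?_
  rw [← G.isCirculation_flow.outflow_compl, ← vol_compl]
  exact G.isCirculation_flow.outflow_le _

/-- Irreducibility: some path from S reaches any vertex, so S cannot be closed. -/
theorem outflow_pos {S : Finset V} (hS : S.Nonempty) (hS' : S ≠ Finset.univ) :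
    0 < outflow G.flow S := by
  refine lt_of_le_of_ne (G.isCirculation_flow.outflow_nonneg S) fun h0 => hS' ?_
  have hzero : ∀ u ∈ S, ∀ v ∉ S, G.P u v = 0 := by
    intro u hu v hv
    have h1 := (Finset.sum_eq_zero_iff_of_nonneg fun u _ => Finset.sum_nonneg fun v _ =>
      G.isCirculation_flow.nonneg u v).1 h0.symm u hu
    have h2 := (Finset.sum_eq_zero_iff_of_nonneg fun v _ =>
      G.isCirculation_flow.nonneg u v).1 h1 v (Finset.mem_compl.2 hv)
    exact (mul_eq_zero.1 h2).resolve_left (G.φ_pos u).ne'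
  obtain ⟨u, hu⟩ := hS
  refine Finset.eq_univ_of_forall fun v => ?_
  let _ : Quiver V := G.P.toQuiver
  obtain ⟨p, -⟩ := G.irreducible.connected u v
  induction p with
  | nil => exact hu
  | @cons w z p e ih =>
    by_contra hz
    exact absurd (hzero w ih z hz) e.down.ne'

theorem conductance_pos {S : Finset V} (hS : S.Nonempty) (hS' : S ≠ Finset.univ) :
    0 < G.conductance S :=
  div_pos (G.outflow_pos hS hS') (G.min_vol_pos hS hS')

theorem lazyP_mem : G.lazyP ∈ Matrix.rowStochastic ℝ V := by
  have := (Matrix.convex_rowStochastic (R := ℝ) (n := V)) (one_mem _) G.stochastic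
    (by norm_num : (0 : ℝ) ≤ 1 / 2) (by norm_num : (0 : ℝ) ≤ 1 / 2) (by norm_num)
  rwa [← smul_add] at this

/-! ### PageRank as a resolvent -/

section PageRank

variable {G} {α : ℝ} {s : V → ℝ}

theorem vecMul_lazyP_pow_nonneg (hs : ∀ v, 0 ≤ s v) (k : ℕ) (v : V) :
    0 ≤ (s ᵥ* G.lazyP ^ k) v :=
  Matrix.nonneg_vecMul_of_mem_rowStochastic (pow_mem G.lazyP_mem k) hs v

theorem vecMul_lazyP_pow_le_one (hs : ∀ v, 0 ≤ s v) (hs1 : ∑ v, s v = 1) (k : ℕ) (v : V) :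
    (s ᵥ* G.lazyP ^ k) v ≤ 1 := by
  have h := Matrix.vecMul_dotProduct_one_eq_one_rowStochastic (pow_mem G.lazyP_mem k)
    (x := s) (by simpa [dotProduct] using hs1)
  simp only [dotProduct, Pi.one_apply, mul_one] at h
  rw [← h]
  exact Finset.single_le_sum (fun w _ => vecMul_lazyP_pow_nonneg hs k w) (Finset.mem_univ v)

theorem summable_pageRank (hα0 : 0 < α) (hα1 : α ≤ 1) (hs : ∀ v, 0 ≤ s v)
    (hs1 : ∑ v, s v = 1) (v : V) :
    Summable fun k : ℕ => (1 - α) ^ k * (s ᵥ* G.lazyP ^ k) v := by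
  have h1 : (0 : ℝ) ≤ 1 - α := by linarith
  refine Summable.of_nonneg_of_le
    (fun k => mul_nonneg (pow_nonneg h1 k) (vecMul_lazyP_pow_nonneg hs k v))
    (fun k => mul_le_of_le_one_right (pow_nonneg h1 k) (vecMul_lazyP_pow_le_one hs hs1 k v))
    (summable_geometric_of_lt_one h1 (by linarith))

theorem pageRank_nonneg (hα0 : 0 < α) (hα1 : α ≤ 1) (hs : ∀ v, 0 ≤ s v) (v : V) :
    0 ≤ G.pageRank α s v :=
  mul_nonneg hα0.le (tsum_nonneg fun k => mul_nonneg (pow_nonneg (by linarith) k)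
    (vecMul_lazyP_pow_nonneg hs k v))

theorem pageRank_eq (hα0 : 0 < α) (hα1 : α ≤ 1) (hs : ∀ v, 0 ≤ s v)
    (hs1 : ∑ v, s v = 1) (v : V) :
    G.pageRank α s v
      = α * s v + (1 - α) / 2 * (G.pageRank α s v + ∑ u, G.pageRank α s u * G.P u v) := by
  have hsum := summable_pageRank (G := G) hα0 hα1 hs hs1
  have hstep : ∀ k : ℕ, (1 - α) ^ (k + 1) * (s ᵥ* G.lazyP ^ (k + 1)) v
      = (1 - α) / 2 * ((1 - α) ^ k * (s ᵥ* G.lazyP ^ k) v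
        + ∑ u, (1 - α) ^ k * (s ᵥ* G.lazyP ^ k) u * G.P u v) := by
    intro k
    have h2 : (s ᵥ* G.lazyP ^ (k + 1)) v
        = 1 / 2 * ((s ᵥ* G.lazyP ^ k) v + ∑ u, (s ᵥ* G.lazyP ^ k) u * G.P u v) := by
      rw [pow_succ, ← Matrix.vecMul_vecMul]
      set x := s ᵥ* G.lazyP ^ k
      rw [lazyP, Matrix.vecMul_smul, Matrix.vecMul_add, Matrix.vecMul_one]
      simp [Matrix.vecMul, dotProduct]
    simp_rw [h2, mul_assoc, ← Finset.mul_sum]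
    ring
  have htail : ∑' k : ℕ, (1 - α) ^ (k + 1) * (s ᵥ* G.lazyP ^ (k + 1)) v
      = (1 - α) / 2 * (∑' k : ℕ, (1 - α) ^ k * (s ᵥ* G.lazyP ^ k) v
        + ∑ u, (∑' k : ℕ, (1 - α) ^ k * (s ᵥ* G.lazyP ^ k) u) * G.P u v) := by
    simp_rw [hstep]
    rw [tsum_mul_left, (hsum v).tsum_add (summable_sum fun u _ => (hsum u).mul_right _),
      Summable.tsum_finsetSum fun u _ => (hsum u).mul_right _]
    simp_rw [tsum_mul_right]
  have h0 : ∑' k : ℕ, (1 - α) ^ k * (s ᵥ* G.lazyP ^ k) v = s v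
      + ∑' k : ℕ, (1 - α) ^ (k + 1) * (s ᵥ* G.lazyP ^ (k + 1)) v := by
    rw [(hsum v).tsum_eq_zero_add]
    simp
  rw [htail] at h0
  simp_rw [pageRank, mul_assoc, ← Finset.mul_sum] at h0 ⊢
  linear_combination α * h0

/-- The ratio of PageRank to the stationary distribution is a resolvent density. -/
theorem isResolvent_pageRank (hα0 : 0 < α) (hα1 : α < 1) (hs : ∀ v, 0 ≤ s v)
    (hs1 : ∑ v, s v = 1) :
    IsResolvent G.flow G.φ (2 * α / (1 - α)) (fun v => s v / G.φ v)
      fun v => G.pageRank α s v / G.φ v := by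
  intro v
  have h := pageRank_eq (G := G) hα0 hα1.le hs hs1 v
  have hφ : ∀ u, G.φ u ≠ 0 := fun u => (G.φ_pos u).ne'
  have h1 : ∑ u, G.flow u v * (G.pageRank α s u / G.φ u - G.pageRank α s v / G.φ v)
      = ∑ u, G.pageRank α s u * G.P u v - G.pageRank α s v := by
    simp_rw [mul_sub, Finset.sum_sub_distrib, ← Finset.sum_mul, G.isCirculation_flow.col_sum]
    rw [mul_div_cancel₀ _ (hφ v)]
    congr 1
    refine Finset.sum_congr rfl fun u _ => ?_
    rw [flow, mul_comm (G.φ u), mul_assoc, mul_div_cancel₀ _ (hφ u), mul_comm]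
  have h2 : 2 * α / (1 - α) * G.φ v * (G.pageRank α s v / G.φ v - s v / G.φ v)
      = 2 * α / (1 - α) * (G.pageRank α s v - s v) := by
    have := hφ v
    field_simp
  have h3 : 1 - α ≠ 0 := by linarith
  rw [h1, h2, div_mul_eq_mul_div, eq_div_iff h3]
  linarith

/-- The support is closed under the walk, hence everything. So the sweep range omits no proper
superlevel set. -/
theorem pageRank_pos (hα0 : 0 < α) (hα1 : α < 1) (hs : ∀ v, 0 ≤ s v)
    (hs1 : ∑ v, s v = 1) (v : V) : 0 < G.pageRank α s v := by
  set p := G.pageRank α s with hp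
  have hp0 : ∀ v, 0 ≤ p v := pageRank_nonneg hα0 hα1.le hs
  have heq := pageRank_eq (G := G) hα0 hα1.le hs hs1
  rw [← hp] at heq
  have hP : ∀ u v, 0 ≤ G.P u v := fun u v => Matrix.nonneg_of_mem_rowStochastic G.stochastic
  have hback : ∀ w, p w = 0 → s w = 0 ∧ ∀ u, p u * G.P u w = 0 := by
    intro w hw
    have h1 := heq w
    have h2 : 0 ≤ ∑ u, p u * G.P u w := Finset.sum_nonneg fun u _ => mul_nonneg (hp0 u) (hP u w)
    rw [hw, zero_add] at h1
    have h3 := mul_nonneg hα0.le (hs w)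
    have h4 := mul_nonneg (by linarith : 0 ≤ (1 - α) / 2) h2
    refine ⟨(mul_eq_zero.1 (by linarith : α * s w = 0)).resolve_left hα0.ne', fun u => ?_⟩
    have h5 := (mul_eq_zero.1 (by linarith : (1 - α) / 2 * ∑ u, p u * G.P u w = 0)).resolve_left
      (by linarith)
    exact (Finset.sum_eq_zero_iff_of_nonneg fun u _ => mul_nonneg (hp0 u) (hP u w)).1 h5 u
      (Finset.mem_univ u)
  set A := Finset.univ.filter fun v => 0 < p v with hA
  have hnA : ∀ w, w ∉ A → p w = 0 := fun w hw =>
    le_antisymm (not_lt.1 fun h => hw (by simpa [hA] using h)) (hp0 w)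
  have hne : A.Nonempty := by
    by_contra h
    rw [Finset.not_nonempty_iff_eq_empty] at h
    have : ∑ v, s v = 0 := Finset.sum_eq_zero fun w _ => (hback w (hnA w (by simp [h]))).1
    linarith
  have huniv : A = Finset.univ := by
    by_contra h
    refine (G.outflow_pos hne h).ne' (Finset.sum_eq_zero fun u hu => Finset.sum_eq_zero
      fun w hw => ?_)
    have hu0 : p u ≠ 0 := by
      have : 0 < p u := by simpa [hA] using hu
      exact this.ne'
    rw [flow, (mul_eq_zero.1 ((hback w (hnA w (Finset.mem_compl.1 hw))).2 u)).resolve_left hu0,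
      mul_zero]
  have : v ∈ A := huniv ▸ Finset.mem_univ v
  simpa [hA] using this

end PageRank

theorem startDist_nonneg {S : Finset V} (hS : S.Nonempty) (v : V) : 0 ≤ G.startDist S v := by
  have := G.vol_pos hS
  have := G.φ_pos v
  rw [startDist]; split_ifs <;> positivity

theorem startDist_sum {S : Finset V} (hS : S.Nonempty) : ∑ v, G.startDist S v = 1 := by
  simp_rw [startDist]
  rw [Finset.sum_ite_mem, Finset.univ_inter, ← Finset.sum_div]
  exact div_self (G.vol_pos hS).ne'

/-! ### Failed sweeps force nearly uniform densities -/

variable {G}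

theorem le_conductance_of_not_bestSweep_lt {p : V → ℝ} {e : Fin (Fintype.card V) ≃ V} {b : ℝ}
    (h : ¬ G.bestSweep p e < (b : WithTop ℝ)) {j : ℕ} (hj : 1 ≤ j)
    (hjN : j ≤ (Finset.univ.filter fun v => p v ≠ 0).card) (hne : sweepSet e j ≠ Finset.univ) :
    b ≤ G.conductance (sweepSet e j) := by
  have h1 : G.bestSweep p e ≤ ((G.conductance (sweepSet e j) : ℝ) : WithTop ℝ) :=
    Finset.inf_le (f := fun j => ((G.conductance (sweepSet e j) : ℝ) : WithTop ℝ))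
      (Finset.mem_filter.2 ⟨Finset.mem_Icc.2 ⟨hj, hjN⟩, hne⟩)
  exact WithTop.coe_le_coe.1 ((not_lt.1 h).trans h1)

/-- A set separated strictly from its complement is an initial segment of every sweep order. -/
theorem exists_sweepSet_eq {p : V → ℝ} {e : Fin (Fintype.card V) ≃ V} (he : G.IsSweepOrder p e)
    {A : Finset V} (hA : A.Nonempty) (hA' : A ≠ Finset.univ)
    (hsep : ∀ u ∈ A, ∀ v ∉ A, p v / G.φ v < p u / G.φ u) :
    ∃ j, 1 ≤ j ∧ j ≤ Fintype.card V ∧ sweepSet e j = A := by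
  have hne : (Finset.univ.filter fun i => e i ∉ A).Nonempty := by
    obtain ⟨v, hv⟩ : ∃ v, v ∉ A := by
      by_contra! h
      exact hA' (Finset.eq_univ_of_forall h)
    exact ⟨e.symm v, by simpa using hv⟩
  -- Positions start at 0, so the first position outside A is the length of the segment.
  obtain ⟨i, hi, hmin⟩ := Finset.exists_min_image _ (fun i => i) hne
  have hiA : e i ∉ A := by simpa using hi
  have hset : sweepSet e i = A := by
    ext v
    rw [sweepSet, Finset.mem_filter]
    constructor
    · rintro ⟨-, hv⟩
      by_contra hvA
      have := hmin (e.symm v) (by simpa using hvA)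
      exact absurd hv (not_lt.2 this)
    · intro hv
      refine ⟨Finset.mem_univ v, ?_⟩
      by_contra hlt
      have h1 : i ≤ e.symm v := not_lt.1 hlt
      have h2 := he h1
      simp only [Equiv.apply_symm_apply] at h2
      exact absurd h2 (not_le.2 (hsep v hv _ hiA))
  refine ⟨i, ?_, i.2.le, hset⟩
  by_contra h0
  obtain ⟨v, hv⟩ := hA
  rw [← hset, sweepSet, Finset.mem_filter] at hv
  omega

/-- The first sweep set is an admissible cut, as V has two vertices, and no conductance exceeds 1.
This later makes α small and excludes α = 1. -/
theorem le_one_of_not_sweepBelow [Nontrivial V] {α b : ℝ} (hα0 : 0 < α) (hα1 : α ≤ 1)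
    {S : Finset V} (hS : S.Nonempty) (h : ¬ G.SweepBelow α S b) : b ≤ 1 := by
  rw [SweepBelow] at h
  push Not at h
  obtain ⟨e, he, hb⟩ := h
  have hs := G.startDist_nonneg hS
  obtain ⟨w, hw⟩ := hS
  have hpos : 0 < G.pageRank α (G.startDist S) w := by
    rw [pageRank_eq hα0 hα1 hs (G.startDist_sum ⟨w, hw⟩) w]
    have h1 := pageRank_nonneg (G := G) hα0 hα1 hs
    have h2 : 0 < G.startDist S w := by
      rw [startDist, if_pos hw]
      exact div_pos (G.φ_pos w) (G.vol_pos ⟨w, hw⟩)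
    have h3 : 0 ≤ ∑ u, G.pageRank α (G.startDist S) u * G.P u w := Finset.sum_nonneg fun u _ =>
      mul_nonneg (h1 u) (Matrix.nonneg_of_mem_rowStochastic G.stochastic)
    have := h1 w
    have : 0 ≤ (1 - α) / 2 := by linarith
    positivity
  have hcard := Fintype.one_lt_card (α := V)
  have hne : sweepSet e 1 ≠ Finset.univ := by
    intro h
    have h1 : e ⟨1, hcard⟩ ∈ sweepSet e 1 := h ▸ Finset.mem_univ _
    simp [sweepSet] at h1
  have hne' : (sweepSet e 1).Nonempty := ⟨e ⟨0, by omega⟩, by simp [sweepSet]⟩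
  refine (le_conductance_of_not_bestSweep_lt (not_lt.2 hb) le_rfl ?_ hne).trans
    (G.conductance_le_one hne' hne)
  exact Finset.card_pos.2 ⟨w, by simpa using hpos.ne'⟩

/-- If the sweep from `T` fails, then the PageRank density from `T` is nearly uniform. The density
is scaled by the volume of `T` so that the empty set is covered. -/
theorem exists_density_of_not_sweepBelow {α b : ℝ} (hα0 : 0 < α) (hα1 : α < 1) (hb : 0 < b)
    {T : Finset V} (h : T.Nonempty → ¬ G.SweepBelow α T b) :
    ∃ q : V → ℝ, IsResolvent G.flow G.φ (2 * α / (1 - α)) (fun v => if v ∈ T then 1 else 0)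
        (fun v => G.vol T * q v) ∧
      (b ^ 2 / (2 * (2 * α / (1 - α)))) ^ 2 * (G.vol T * ∑ v, G.φ v * (q v - 1) ^ 2) ≤ 1 := by
  rcases T.eq_empty_or_nonempty with rfl | hT
  · exact ⟨fun _ => 1, fun v => by simp [vol], by simp⟩
  have hs := G.startDist_nonneg hT
  have hs1 := G.startDist_sum hT
  have hvol := G.vol_pos hT
  have hκ : 0 < 2 * α / (1 - α) := div_pos (by linarith) (by linarith)
  have hres := isResolvent_pageRank (G := G) hα0 hα1 hs hs1
  have hσ : ∀ v, G.startDist T v / G.φ v = if v ∈ T then (G.vol T)⁻¹ else 0 := fun v => by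
    have := (G.φ_pos v).ne'
    rw [startDist]
    split_ifs
    · field_simp
    · simp
  simp_rw [hσ] at hres
  refine ⟨fun v => G.pageRank α (G.startDist T) v / G.φ v, fun v => ?_, ?_⟩
  · have h1 := congrArg (G.vol T * ·) (hres v)
    simp only [Finset.mul_sum] at h1
    calc _ = _ := Finset.sum_congr rfl fun u _ => by ring
      _ = _ := h1
      _ = _ := by
        by_cases hv : v ∈ T
        · simp only [hv, if_true]
          field_simp
        · simp only [hv, if_false]
          ring
  · have h0 := h hT
    rw [SweepBelow] at h0
    push Not at h0
    obtain ⟨e, he, hbest⟩ := h0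
    have hσsum : ∑ v, G.φ v * (if v ∈ T then (G.vol T)⁻¹ else 0) = 1 := by
      simp_rw [mul_ite, mul_zero]
      rw [Finset.sum_ite_mem, Finset.univ_inter, ← Finset.sum_mul]
      exact mul_inv_cancel₀ hvol.ne'
    have hvar := hres.variance_le G.isCirculation_flow hκ G.φ_sum hσsum hb fun A hA hA' hsep => by
      obtain ⟨j, hj1, hj2, rfl⟩ := exists_sweepSet_eq he hA hA' hsep
      have hsupp : (Finset.univ.filter fun v => G.pageRank α (G.startDist T) v ≠ 0)
          = Finset.univ :=
        Finset.filter_true_of_mem fun v _ => (pageRank_pos hα0 hα1 hs hs1 v).ne'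
      have := le_conductance_of_not_bestSweep_lt (not_lt.2 hbest) hj1
        (by rw [hsupp]; exact hj2) hA'
      rwa [conductance, le_div_iff₀ (G.min_vol_pos hA hA')] at this
    have hnorm : G.vol T * ∑ v, G.φ v * ((if v ∈ T then (G.vol T)⁻¹ else 0) - 1) ^ 2 ≤ 1 := by
      have e1 : ∑ v, G.φ v * ((if v ∈ T then (G.vol T)⁻¹ else 0) - 1) ^ 2
          = (G.vol T)⁻¹ * 1 - 2 * 1 + 1 := by
        calc _ = ∑ v, ((G.vol T)⁻¹ * (G.φ v * (if v ∈ T then (G.vol T)⁻¹ else 0))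
              - 2 * (G.φ v * (if v ∈ T then (G.vol T)⁻¹ else 0)) + G.φ v) :=
              Finset.sum_congr rfl fun v _ => by split_ifs <;> ring
          _ = _ := by
            rw [Finset.sum_add_distrib, Finset.sum_sub_distrib, ← Finset.mul_sum,
              ← Finset.mul_sum, hσsum, G.φ_sum]
      rw [e1]
      have : G.vol T * ((G.vol T)⁻¹ * 1 - 2 * 1 + 1) = 1 - G.vol T := by
        field_simp; ring
      linarith
    calc _ = G.vol T * ((b ^ 2 / (2 * (2 * α / (1 - α)))) ^ 2 *
          ∑ v, G.φ v * (G.pageRank α (G.startDist T) v / G.φ v - 1) ^ 2) := by ring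
      _ ≤ _ := mul_le_mul_of_nonneg_left hvar hvol.le
      _ ≤ 1 := hnorm

/-- If the sweeps from `S` and from `C \ S` both fail, then the PageRank density from `C` is nearly
uniform. -/
theorem exists_density_of_both_fail {α b : ℝ} (hα0 : 0 < α) (hα1 : α < 1) (hb : 0 < b)
    {S C : Finset V} (hSC : S ⊆ C) (hC : C.Nonempty)
    (h1 : S.Nonempty → ¬ G.SweepBelow α S b) (h2 : (C \ S).Nonempty → ¬ G.SweepBelow α (C \ S) b) :
    ∃ q : V → ℝ, IsResolvent G.flow G.φ (2 * α / (1 - α))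
        (fun v => if v ∈ C then (G.vol C)⁻¹ else 0) q ∧
      (b ^ 2 / (2 * (2 * α / (1 - α)))) ^ 2 * (G.vol C * ∑ v, G.φ v * (q v - 1) ^ 2) ≤ 2 := by
  obtain ⟨q₁, hq₁, hv₁⟩ := exists_density_of_not_sweepBelow hα0 hα1 hb h1
  obtain ⟨q₂, hq₂, hv₂⟩ := exists_density_of_not_sweepBelow hα0 hα1 hb h2
  have hc := G.vol_pos hC
  have hab : G.vol (C \ S) + G.vol S = G.vol C := Finset.sum_sdiff hSC
  have ha : 0 ≤ G.vol S := Finset.sum_nonneg fun v _ => (G.φ_pos v).le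
  have hb' : 0 ≤ G.vol (C \ S) := Finset.sum_nonneg fun v _ => (G.φ_pos v).le
  refine ⟨fun v => (G.vol C)⁻¹ * (G.vol S * q₁ v + G.vol (C \ S) * q₂ v), fun v => ?_, ?_⟩
  · have e : ∑ u, G.flow u v * ((G.vol C)⁻¹ * (G.vol S * q₁ u + G.vol (C \ S) * q₂ u)
        - (G.vol C)⁻¹ * (G.vol S * q₁ v + G.vol (C \ S) * q₂ v))
        = (G.vol C)⁻¹ * (∑ u, G.flow u v * (G.vol S * q₁ u - G.vol S * q₁ v)
          + ∑ u, G.flow u v * (G.vol (C \ S) * q₂ u - G.vol (C \ S) * q₂ v)) := by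
      rw [← Finset.sum_add_distrib, Finset.mul_sum]
      exact Finset.sum_congr rfl fun u _ => by ring
    rw [e, hq₁ v, hq₂ v]
    by_cases hvC : v ∈ C
    · by_cases hvS : v ∈ S
      · simp only [hvC, hvS, Finset.mem_sdiff, not_true, and_false, if_true, if_false]; ring
      · simp only [hvC, hvS, Finset.mem_sdiff, not_false_eq_true, and_true, if_true, if_false]; ring
    · have hvS : v ∉ S := fun h => hvC (hSC h)
      simp only [hvC, hvS, Finset.mem_sdiff, false_and, if_false]; ring
  · have hconv : G.vol C * ∑ v, G.φ v *
        ((G.vol C)⁻¹ * (G.vol S * q₁ v + G.vol (C \ S) * q₂ v) - 1) ^ 2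
        ≤ G.vol S * ∑ v, G.φ v * (q₁ v - 1) ^ 2
          + G.vol (C \ S) * ∑ v, G.φ v * (q₂ v - 1) ^ 2 := by
      simp_rw [Finset.mul_sum]
      rw [← Finset.sum_add_distrib]
      refine Finset.sum_le_sum fun v _ => ?_
      rw [← hab] at hc ⊢
      set a := G.vol S
      set d := G.vol (C \ S)
      -- The convexity defect is an explicit multiple of (q₁ - q₂)².
      have e : a * (G.φ v * (q₁ v - 1) ^ 2) + d * (G.φ v * (q₂ v - 1) ^ 2)
          - (d + a) * (G.φ v * ((d + a)⁻¹ * (a * q₁ v + d * q₂ v) - 1) ^ 2)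
          = G.φ v * (a * d * (d + a)⁻¹ * (q₁ v - q₂ v) ^ 2) := by
        field_simp
        ring
      have : 0 ≤ G.φ v * (a * d * (d + a)⁻¹ * (q₁ v - q₂ v) ^ 2) := by
        have := G.φ_pos v
        positivity
      linarith
    have := mul_le_mul_of_nonneg_left hconv
      (sq_nonneg (b ^ 2 / (2 * (2 * α / (1 - α)))))
    linarith

/-! ### The contradiction when both sweeps fail -/

theorem two_mul_outflow_le {C : Finset V} (hC : C.Nonempty) (hC2 : G.vol C ≤ 1 / 2)
    (hα1 : G.conductance C < 1) :
    2 * outflow G.flow C ≤ 2 * G.conductance C / (1 - G.conductance C) * G.vol C := by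
  have hc := G.vol_pos hC
  have h1 : outflow G.flow C = G.conductance C * G.vol C := by
    rw [conductance, min_eq_left (by linarith), boundary_eq, div_mul_cancel₀ _ hc.ne']
  have h3 : 0 ≤ G.conductance C := by
    rw [conductance, min_eq_left (by linarith), boundary_eq]
    exact div_nonneg (G.isCirculation_flow.outflow_nonneg C) hc.le
  have h2 : 2 * G.conductance C ≤ 2 * G.conductance C / (1 - G.conductance C) := by
    rw [le_div_iff₀ (by linarith)]
    nlinarith
  rw [h1, ← mul_assoc]
  exact mul_le_mul_of_nonneg_right h2 hc.le

theorem mul_conductance_le_one_of_fail [Nontrivial V] {r : ℝ} {S C : Finset V}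
    (hC : C.Nonempty) (hC' : C ≠ Finset.univ)
    (h1 : ¬ G.SweepBelow (G.conductance C) S √(r * G.conductance C))
    (h2 : ¬ G.SweepBelow (G.conductance C) (C \ S) √(r * G.conductance C)) :
    r * G.conductance C ≤ 1 := by
  have hα0 := G.conductance_pos hC hC'
  have hα1 := G.conductance_le_one hC hC'
  have h3 : √(r * G.conductance C) ≤ 1 := by
    rcases S.eq_empty_or_nonempty with rfl | hS
    · rw [Finset.sdiff_empty] at h2
      exact le_one_of_not_sweepBelow hα0 hα1 hC h2
    · exact le_one_of_not_sweepBelow hα0 hα1 hS h1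
  exact Real.sqrt_le_one.1 h3

theorem sq_sqrt_div {α r : ℝ} (hα0 : 0 < α) (hα1 : α < 1) (hr : 0 ≤ r) :
    √(r * α) ^ 2 / (2 * (2 * α / (1 - α))) = r / 4 * (1 - α) := by
  rw [Real.sq_sqrt (mul_nonneg hr hα0.le)]
  have : 1 - α ≠ 0 := by linarith
  field_simp
  ring

/-- One of the sweeps from `S` and `C \ S` succeeds if the volume of `C` is at most `1 / 3`. -/
theorem sweepBelow_or_of_vol_le_third [Nontrivial V] {r : ℝ} (hr : 235 ≤ r) {S C : Finset V}
    (hSC : S ⊆ C) (hC : C.Nonempty) (hC' : C ≠ Finset.univ) (hC3 : G.vol C ≤ 1 / 3) :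
    G.SweepBelow (G.conductance C) S √(r * G.conductance C) ∨
      G.SweepBelow (G.conductance C) (C \ S) √(r * G.conductance C) := by
  by_contra! hfail
  obtain ⟨h1, h2⟩ := hfail
  have hα0 := G.conductance_pos hC hC'
  have hrα := mul_conductance_le_one_of_fail hC hC' h1 h2
  have hα : 235 * G.conductance C ≤ 1 := by nlinarith
  obtain ⟨q, hq, hvar⟩ := exists_density_of_both_fail hα0 (by linarith)
    (Real.sqrt_pos.2 (by positivity)) hSC hC (fun _ => h1) fun _ => h2
  have hκ : 0 < 2 * G.conductance C / (1 - G.conductance C) :=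
    div_pos (by linarith) (by linarith)
  have hlow := IsResolvent.one_le_variance G.isCirculation_flow G.φ_sum (G.vol_pos hC) hC3
    (fun _ => rfl) hq hκ G.φ_pos (two_mul_outflow_le hC (by linarith) (by linarith))
  rw [sq_sqrt_div hα0 (by linarith) (by linarith)] at hvar
  -- (235 - 1)/4 = 58.5, and 58²/36 > 2.
  have hD : 58 ≤ r / 4 * (1 - G.conductance C) := by nlinarith
  have hD2 : (58 : ℝ) ^ 2 ≤ (r / 4 * (1 - G.conductance C)) ^ 2 :=
    pow_le_pow_left₀ (by norm_num) hD 2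
  have hlow' : 1 / 36 ≤ G.vol C * ∑ v, G.φ v * (q v - 1) ^ 2 := by
    unfold vol; linarith
  have := mul_le_mul hD2 hlow' (by norm_num) (sq_nonneg _)
  linarith

/-- One of the sweeps from `S` and `C \ S` succeeds if the volume of `C` is at most `1 / 2`. -/
theorem sweepBelow_or_of_vol_le_half [Nontrivial V] {S C : Finset V}
    (hSC : S ⊆ C) (hC : C.Nonempty) (hC' : C ≠ Finset.univ) (hC2 : G.vol C ≤ 1 / 2) :
    G.SweepBelow (G.conductance C) S √(10000 * G.conductance C) ∨
      G.SweepBelow (G.conductance C) (C \ S) √(10000 * G.conductance C) := by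
  rcases le_total (G.vol C) (1 / 3) with hC3 | hC3
  · exact sweepBelow_or_of_vol_le_third (by norm_num) hSC hC hC' hC3
  by_contra! hfail
  obtain ⟨h1, h2⟩ := hfail
  have hα0 := G.conductance_pos hC hC'
  have hα := mul_conductance_le_one_of_fail hC hC' h1 h2
  obtain ⟨q, hq, hvar⟩ := exists_density_of_both_fail hα0 (by linarith)
    (Real.sqrt_pos.2 (by positivity)) hSC hC (fun _ => h1) fun _ => h2
  have hκ : 0 < 2 * G.conductance C / (1 - G.conductance C) :=
    div_pos (by linarith) (by linarith)
  have hlow := IsResolvent.variance_gt G.isCirculation_flow G.φ_sum hC3 hC2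
    (fun _ => rfl) hq hκ G.φ_pos (two_mul_outflow_le hC hC2 (by linarith))
  rw [sq_sqrt_div hα0 (by linarith) (by norm_num)] at hvar
  -- Here α ≤ 1/10000, and 2000²/30000 > 2.
  have hD : 2000 ≤ 10000 / 4 * (1 - G.conductance C) := by linarith
  have hD2 : (2000 : ℝ) ^ 2 ≤ (10000 / 4 * (1 - G.conductance C)) ^ 2 :=
    pow_le_pow_left₀ (by norm_num) hD 2
  have hlow' : 1 / 3 * (1 / 10000) ≤ G.vol C * ∑ v, G.φ v * (q v - 1) ^ 2 :=
    mul_le_mul hC3 hlow.le (by norm_num) (by linarith)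
  have := mul_le_mul hD2 hlow' (by norm_num) (sq_nonneg _)
  linarith

end WeightedGraphWalk

/-! ### Counting with the involution -/

/-- If an involution of `A` maps every failure to a success, then success is likely given `A`. -/
theorem halfLikely_of_involution {V : Type*} [Fintype V] [DecidableEq V] {A B : Set (Finset V)}
    (ι : Finset V → Finset V) (hmaps : ∀ S ∈ A, ι S ∈ A) (hinv : ∀ S ∈ A, ι (ι S) = S)
    (hor : ∀ S ∈ A, S ∈ B ∨ ι S ∈ B) : HalfLikely A B := by
  classical
  have hcard : A.ncard ≤ 2 * (A ∩ B).ncard := by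
    have hsub : A ⊆ (A ∩ B) ∪ ι '' (A ∩ B) := fun S hS => by
      rcases hor S hS with h | h
      · exact Or.inl ⟨hS, h⟩
      · exact Or.inr ⟨ι S, ⟨hmaps S hS, h⟩, hinv S hS⟩
    have h1 := Set.ncard_le_ncard hsub (Set.toFinite _)
    have h2 := Set.ncard_union_le (A ∩ B) (ι '' (A ∩ B))
    have h3 := Set.ncard_image_le (f := ι) (Set.toFinite (A ∩ B))
    omega
  unfold HalfLikely seedProb
  rw [PMF.toOuterMeasure_uniformOfFintype_apply, PMF.toOuterMeasure_uniformOfFintype_apply,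
    ← Nat.card_eq_fintype_card (α := A), ← Nat.card_eq_fintype_card (α := ↑(A ∩ B)),
    Nat.card_coe_set_eq, Nat.card_coe_set_eq, ← mul_div_assoc]
  refine ENNReal.div_le_div_right ?_ _
  rw [one_div, ENNReal.inv_mul_le_iff (by norm_num) (by norm_num)]
  exact_mod_cast hcard

namespace WeightedGraphWalk

variable {V : Type*} [Fintype V] [DecidableEq V] {G : WeightedGraphWalk V}

/-- Passing from `S` to `S* \ S` shows that at least half of the good seed sets succeed. -/
theorem halfLikely_goodSeeds {opt : Finset V → Finset V}
    (hopt : ∀ S : Finset V, S ≠ Finset.univ → G.IsOptimal S (opt S)) {r : ℝ} {f : ℝ → ℝ}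
    (hor : ∀ S C : Finset V, S ⊆ C → C.Nonempty → C ≠ Finset.univ → G.vol C ≤ r →
      G.SweepBelow (G.conductance C) S (f (G.conductance C)) ∨
        G.SweepBelow (G.conductance C) (C \ S) (f (G.conductance C)))
    (Q : Finset V → Prop) :
    HalfLikely (G.goodSeeds opt r ∩ {S | Q (opt S)}) (G.successSeeds opt f) := by
  refine halfLikely_of_involution (fun S => opt S \ S) ?_ ?_ ?_
  · rintro S ⟨⟨hS, hvol, hstar⟩, hQ⟩
    obtain ⟨⟨hsub, hne, hne'⟩, -⟩ := hopt S hS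
    refine ⟨⟨fun h => hne' ?_, ?_, ?_⟩, ?_⟩
    · exact Finset.univ_subset_iff.1 (h ▸ Finset.sdiff_subset)
    · rwa [hstar]
    · rw [hstar, Finset.sdiff_sdiff_eq_self hsub]
    · rwa [Set.mem_ofPred_eq, hstar]
  · rintro S ⟨⟨hS, -, hstar⟩, -⟩
    simp only [hstar]
    exact Finset.sdiff_sdiff_eq_self (hopt S hS).1.1
  · rintro S ⟨⟨hS, hvol, hstar⟩, -⟩
    obtain ⟨⟨hsub, hne, hne'⟩, -⟩ := hopt S hS
    simp only [successSeeds, Set.mem_ofPred_eq, hstar]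
    exact hor S (opt S) hsub hne hne' hvol

end WeightedGraphWalk

theorem theorem1 :
    ∃ K : ℝ, 0 < K ∧
      ∀ (V : Type*) [Fintype V] [DecidableEq V] [Nontrivial V] (G : WeightedGraphWalk V)
        (opt : Finset V → Finset V),
        (∀ S : Finset V, S ≠ Finset.univ → G.IsOptimal S (opt S)) →
          (HalfLikely (G.goodSeeds opt (1 / 2)) (G.successSeeds opt fun x => K * √x) ∧
            HalfLikely (G.goodSeeds opt (1 / 3)) (G.successSeeds opt fun x => √(235 * x))) ∧
          ∀ C : Finset V,
            HalfLikely (G.goodSeeds opt (1 / 2) ∩ {S | opt S = C})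
              (G.successSeeds opt fun x => K * √x) ∧
            HalfLikely (G.goodSeeds opt (1 / 3) ∩ {S | opt S = C})
              (G.successSeeds opt fun x => √(235 * x)) := by
  refine ⟨100, by norm_num, fun V _ _ _ G opt hopt => ?_⟩
  have hK : (fun x : ℝ => 100 * √x) = fun x => √(10000 * x) := by
    funext x
    rw [Real.sqrt_mul (by norm_num), show (10000 : ℝ) = 100 ^ 2 by norm_num,
      Real.sqrt_sq (by norm_num)]
  rw [hK]
  have h2 := WeightedGraphWalk.halfLikely_goodSeeds hopt (r := 1 / 2) (f := fun x => √(10000 * x))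
    fun S C h1 h2 h3 h4 => WeightedGraphWalk.sweepBelow_or_of_vol_le_half h1 h2 h3 h4
  have h3 := WeightedGraphWalk.halfLikely_goodSeeds hopt (r := 1 / 3) (f := fun x => √(235 * x))
    fun S C h1 h2 h3 h4 => WeightedGraphWalk.sweepBelow_or_of_vol_le_third le_rfl h1 h2 h3 h4
  exact ⟨⟨by simpa using h2 fun _ => True, by simpa using h3 fun _ => True⟩,
    fun C => ⟨h2 (· = C), h3 (· = C)⟩⟩
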